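/- Let $X$ and $Z$ be irreducible complex algebraic varieties (integral separated schemes of finite type over $\mathbb{C}$). A \emph{branched cover} $\pi\colon X \dashrightarrow Z$ is a dominant rational map over $\mathbb{C}$ between irreducible varieties of the same dimension; its degree is $d=[\mathbb{C}(X):\mathbb{C}(Z)]$, where $\mathbb{C}(Z)$ is regarded as a subfield of $\mathbb{C}(X)$ via pullback of rational functions, and $\pi$ is \emph{trivial} if $d=1$. Let $K$ be the Galois closure of $\mathbb{C}(X)/\mathbb{C}(Z)$; the \emph{Galois group} of $\pi$ is $G_\pi=\mathrm{Gal}(K/\mathbb{C}(Z))$, viewed as a transitive permutation group on the $d$ embeddings of $\mathbb{C}(X)$ into $K$ over $\mathbb{C}(Z)$ (equivalently, on the cosets $G_\pi/H$, where $\mathbb{C}(X)=K^H$). A \emph{block} of $G_\pi$ is a subset $B$ of this $d$-element set such that for each $g\in G_\pi$ either $gB=B$ or $gB\cap B=\emptyset$. The empty set, the singletons and the whole set are the trivial blocks, and $G_\pi$ is \emph{imprimitive} if it has a nontrivial block. The branched cover $\pi$ is \emph{decomposable} if there are a dense open subset $V\subseteq Z$, an irreducible variety $Y$, and regular maps $$\pi^{-1}(V)\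 \xrightarrow{\ \varphi\ }\ Y\ \xrightarrow{\ \psi\ }\ V$$ with $\psi\circ\varphi=\pi|_{\pi^{-1}(V)}$, such that $\varphi$ and $\psi$ are both nontrivial branched covers; here $\pi^{-1}(V)$ is the preimage of $V$ in the domain of definition of $\pi$. Then every branched cover $\pi$ is decomposable if and only if its Galois group $G_\pi$ is imprimitive. -/

import Mathlib

open CategoryTheory AlgebraicGeometry

noncomputable section

/-! ### Permutation groups -/

/-- A group action is imprimitive if it has a nontrivial block: a block which is neither
empty, nor a single point, nor everything. -/
def IsImprimitive (G α : Type*) [Group G] [MulAction G α] : Prop :=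
  ∃ B : Set α, MulAction.IsBlock G B ∧ ¬ MulAction.IsTrivialBlock B

/-! ### The Galois group of a field extension as a permutation group -/

/-- The Galois closure of `E / F`, inside an algebraic closure of `E`. -/
abbrev GaloisClosure (F E : Type*) [Field F] [Field E] [Algebra F E] :
    IntermediateField F (AlgebraicClosure E) :=
  IntermediateField.normalClosure F E (AlgebraicClosure E)

/-- The Galois group of the Galois closure of `E / F`. -/
abbrev GaloisClosureGroup (F E : Type*) [Field F] [Field E] [Algebra F E] : Type _ :=
  GaloisClosure F E ≃ₐ[F] GaloisClosure F E

/-- The conjugates of `E / F`: the `F`-embeddings of `E` into the Galois closure of `E / F`. For a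
finite separable extension there are exactly `[E : F]` of them. -/
abbrev Conjugates (F E : Type*) [Field F] [Field E] [Algebra F E] : Type _ :=
  E →ₐ[F] GaloisClosure F E

/-- The Galois group permutes the conjugates by composition. -/
instance galoisAction (F E : Type*) [Field F] [Field E] [Algebra F E] :
    MulAction (GaloisClosureGroup F E) (Conjugates F E) where
  smul g σ := (g : GaloisClosure F E →ₐ[F] GaloisClosure F E).comp σ
  one_smul _ := rfl
  mul_smul _ _ _ := rfl

/-! ### Complex varieties -/

/-- The base scheme `Spec ℂ`. -/
abbrev SpecC : Scheme.{0} := Spec (CommRingCat.of ℂ)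

/-- An irreducible complex variety: an integral separated scheme of finite type over `ℂ`. -/
class IsComplexVariety (X : Scheme.{0}) [X.Over SpecC] : Prop where
  isIntegral : IsIntegral X
  isSeparated : IsSeparated (X ↘ SpecC)
  locallyOfFiniteType : LocallyOfFiniteType (X ↘ SpecC)
  quasiCompact : QuasiCompact (X ↘ SpecC)

theorem IsComplexVariety.scheme_isSeparated (X : Scheme.{0}) [X.Over SpecC]
    [IsComplexVariety X] : X.IsSeparated := by
  have := IsComplexVariety.isSeparated (X := X)
  constructor
  rw [← Limits.terminal.comp_from (X ↘ SpecC)]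
  infer_instance

/-! ### Function fields -/

theorem genericPoint_map {X Z : Scheme.{0}} [IsIntegral X] [IsIntegral Z] (f : X ⟶ Z)
    [IsDominant f] : f (genericPoint X) = genericPoint Z :=
  (((genericPoint_spec X).image f.continuous).eq
    (by
      rw [Set.image_univ, f.denseRange.closure_eq]
      exact genericPoint_spec Z))

/-- The pullback `ℂ(Z) → ℂ(X)` of rational functions along a dominant morphism `X ⟶ Z` of integral
schemes. -/
def functionFieldPullback {X Z : Scheme.{0}} [IsIntegral X] [IsIntegral Z] (f : X ⟶ Z)
    [IsDominant f] : Z.functionField →+* X.functionField :=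
  (Z.presheaf.stalkSpecializes (specializes_of_eq (genericPoint_map f)) ≫
    f.stalkMap (genericPoint X)).hom

/-- The function field of the source of a dominant morphism `f : X ⟶ Z`, seen as an extension of the
function field of `Z`. -/
def SourceField {X Z : Scheme.{0}} [IsIntegral X] [IsIntegral Z] (f : X ⟶ Z)
    [IsDominant f] : Type :=
  X.functionField

instance {X Z : Scheme.{0}} [IsIntegral X] [IsIntegral Z] (f : X ⟶ Z) [IsDominant f] :
    Field (SourceField f) :=
  inferInstanceAs (Field X.functionField)

instance {X Z : Scheme.{0}} [IsIntegral X] [IsIntegral Z] (f : X ⟶ Z) [IsDominant f] :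
    Algebra Z.functionField (SourceField f) :=
  RingHom.toAlgebra (S := SourceField f) (functionFieldPullback f)

/-- The degree `[ℂ(X) : ℂ(Z)]` of a dominant morphism. -/
def mapDegree {X Z : Scheme.{0}} [IsIntegral X] [IsIntegral Z] (f : X ⟶ Z)
    [IsDominant f] : ℕ :=
  Module.finrank Z.functionField (SourceField f)

/-! ### Branched covers -/

/-- A regular map which is a branched cover: a dominant morphism over `ℂ` of irreducible complex
varieties of the same dimension. -/
structure IsRegularBranchedCover {X Z : Scheme.{0}} [X.Over SpecC] [Z.Over SpecC]
    (f : X ⟶ Z) : Prop where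
  source : IsComplexVariety X
  target : IsComplexVariety Z
  isOver : f.IsOver SpecC
  isDominant : IsDominant f
  dim_eq : topologicalKrullDim X = topologicalKrullDim Z

/-- The degree of a branched cover. -/
def IsRegularBranchedCover.degree {X Z : Scheme.{0}} [X.Over SpecC] [Z.Over SpecC]
    {f : X ⟶ Z} (h : IsRegularBranchedCover f) : ℕ :=
  haveI := h.source.isIntegral
  haveI := h.target.isIntegral
  haveI := h.isDominant
  mapDegree f

/-- A (possibly only rational) map which is a branched cover: a dominant rational map over `ℂ` of
irreducible complex varieties of the same dimension. -/
structure IsBranchedCover {X Z : Scheme.{0}} [X.Over SpecC] [Z.Over SpecC]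
    (π : X ⤏ Z) : Prop where
  source : IsComplexVariety X
  target : IsComplexVariety Z
  isOver : π.IsOver SpecC
  isDominant : π.IsDominant
  dim_eq : topologicalKrullDim X = topologicalKrullDim Z

namespace IsBranchedCover

/-- The domain of definition of a branched cover, as a scheme. -/
abbrev domain {X Z : Scheme.{0}} [X.Over SpecC] [Z.Over SpecC] {π : X ⤏ Z}
    (_h : IsBranchedCover π) : Scheme.{0} :=
  π.domain.toScheme

/-- The regular map defined by a branched cover on its domain of definition. -/
def regularMap {X Z : Scheme.{0}} [X.Over SpecC] [Z.Over SpecC] {π : X ⤏ Z}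
    (h : IsBranchedCover π) : h.domain ⟶ Z :=
  haveI := h.source.isIntegral
  haveI := h.target
  haveI := IsComplexVariety.scheme_isSeparated Z
  π.toPartialMap.hom

theorem isIntegral_domain {X Z : Scheme.{0}} [X.Over SpecC] [Z.Over SpecC] {π : X ⤏ Z}
    (h : IsBranchedCover π) : IsIntegral h.domain :=
  haveI := h.source.isIntegral
  haveI : Nonempty π.domain := π.dense_domain.nonempty.to_subtype
  inferInstance

theorem isDominant_regularMap {X Z : Scheme.{0}} [X.Over SpecC] [Z.Over SpecC] {π : X ⤏ Z}
    (h : IsBranchedCover π) : IsDominant h.regularMap := by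
  have := h.source.isIntegral
  have := h.target
  have := IsComplexVariety.scheme_isSeparated Z
  have := h.isDominant
  change IsDominant π.toPartialMap.hom
  rwa [← Scheme.PartialMap.isDominant_toRationalMap_iff,
    Scheme.RationalMap.toRationalMap_toPartialMap]

/-- A branched cover `π` is decomposable if there is a dense open `V ⊆ Z` over which it factors as
`π⁻¹(V) ⟶ Y ⟶ V` with both maps branched covers of degree different from `1`. -/
def IsDecomposable {X Z : Scheme.{0}} [X.Over SpecC] [Z.Over SpecC] {π : X ⤏ Z}
    (h : IsBranchedCover π) : Prop :=
  ∃ V : Z.Opens, Dense (V : Set Z) ∧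
    ∃ (Y : Scheme.{0}) (_ : Y.Over SpecC)
      (φ : (h.regularMap ⁻¹ᵁ V).toScheme ⟶ Y) (ψ : Y ⟶ V.toScheme)
      (hφ : IsRegularBranchedCover φ) (hψ : IsRegularBranchedCover ψ),
      φ ≫ ψ = h.regularMap ∣_ V ∧ hφ.degree ≠ 1 ∧ hψ.degree ≠ 1

/-- The Galois group of a branched cover, acting on the conjugates of `ℂ(X) / ℂ(Z)`, is
imprimitive. Here `ℂ(X)` is the function field of the (dense open) domain of definition. -/
def HasImprimitiveGaloisGroup {X Z : Scheme.{0}} [X.Over SpecC] [Z.Over SpecC] {π : X ⤏ Z}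
    (h : IsBranchedCover π) : Prop :=
  haveI := h.isIntegral_domain
  haveI := h.target.isIntegral
  haveI := h.isDominant_regularMap
  IsImprimitive (GaloisClosureGroup Z.functionField (SourceField h.regularMap))
    (Conjugates Z.functionField (SourceField h.regularMap))

end IsBranchedCover

end

/-! Write F = ℂ(Z) and E = ℂ(X). Both conditions say that E/F has an intermediate field other than F
and E.

Equal dimensions mean equal transcendence degrees over ℂ, so E/F is algebraic; as E is essentially
of finite type over ℂ, E/F is finite (`topologicalKrullDim_eq_iff_isAlgebraic`,
`finiteDimensional_sourceField`). It is separable by characteristic 0.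

Group side (`isImprimitive_galois_iff`): the blocks through an embedding σ are its orbits under the
subgroups between the stabilizer of σ and the whole group. That stabilizer is Gal(K/σ(E)), so the
Galois correspondence matches these subgroups with the subfields of E/F.

Geometric side: a factorization through Y places ℂ(Y) strictly between F and E. Conversely, let L =
F(β) and let W be a nonempty affine open of Z. Some nonzero a in Γ(W) makes s = aβ regular on all of
π⁻¹(W), so W need not be shrunk. The inclusions Γ(W) ⊆ Γ(W)[s] ⊆ Γ(π⁻¹(W)) then give the
factorization through Y = Spec Γ(W)[s], whose function field is L
(`exists_factorization_of_intermediateField`). -/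

/-! ### Blocks of the Galois group and intermediate fields -/

section Imprimitive

open MulAction IntermediateField IsGalois
open scoped Pointwise

variable {F E : Type*} [Field F] [Field E] [Algebra F E]

/-- Transitivity: the isomorphism between the images of σ and τ extends to an automorphism because
the Galois closure is normal. -/
theorem exists_galois_smul_eq [FiniteDimensional F E] (σ τ : Conjugates F E) :
    ∃ g : GaloisClosureGroup F E, g • σ = τ := by
  let χ : σ.fieldRange ≃ₐ[F] τ.fieldRange :=
    (AlgEquiv.ofInjectiveField σ).symm.trans (AlgEquiv.ofInjectiveField τ)
  refine ⟨χ.liftNormal (GaloisClosure F E), AlgHom.ext fun x ↦ ?_⟩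
  have h := χ.liftNormal_commutes (GaloisClosure F E) (AlgEquiv.ofInjectiveField σ x)
  have h' : χ (AlgEquiv.ofInjectiveField σ x) = AlgEquiv.ofInjectiveField τ x :=
    congrArg (AlgEquiv.ofInjectiveField τ) ((AlgEquiv.ofInjectiveField σ).symm_apply_apply x)
  rw [h'] at h
  exact h

theorem isPretransitive_galoisAction [FiniteDimensional F E] :
    IsPretransitive (GaloisClosureGroup F E) (Conjugates F E) :=
  ⟨exists_galois_smul_eq⟩

theorem stabilizer_conjugate (σ : Conjugates F E) :
    stabilizer (GaloisClosureGroup F E) σ = σ.fieldRange.fixingSubgroup := by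
  ext g
  rw [mem_stabilizer_iff, IntermediateField.mem_fixingSubgroup_iff]
  constructor
  · rintro h _ ⟨x, rfl⟩
    exact DFunLike.congr_fun h x
  · intro h
    exact AlgHom.ext fun x ↦ h _ ⟨x, rfl⟩

theorem isImprimitive_galois_iff [FiniteDimensional F E] [CharZero F] :
    IsImprimitive (GaloisClosureGroup F E) (Conjugates F E) ↔
      ∃ L : IntermediateField F E, L ≠ ⊥ ∧ L ≠ ⊤ := by
  have := isPretransitive_galoisAction (F := F) (E := E)
  have : IsGalois F (GaloisClosure F E) := ⟨⟩
  constructor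
  · rintro ⟨B, hB, hB'⟩
    rw [IsTrivialBlock, not_or, Set.not_subsingleton_iff] at hB'
    obtain ⟨σ, hσ⟩ := hB'.1.nonempty
    set H := stabilizer (GaloisClosureGroup F E) B
    have hle : fixedField H ≤ σ.fieldRange := by
      rw [← fixedField_fixingSubgroup σ.fieldRange, ← stabilizer_conjugate]
      exact fixedField_antitone (hB.stabilizer_le hσ)
    have hmap : ((fixedField H).comap σ).map σ = fixedField H := by
      ext x
      constructor
      · rintro ⟨y, hy, rfl⟩
        exact hy
      · intro hx
        obtain ⟨y, rfl⟩ := hle hx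
        exact ⟨y, hx, rfl⟩
    -- The block B is the orbit of σ under H. If the field is F, then H is the whole group and B is
    -- everything; if it is E, then H is the stabilizer of σ and B is a single point.
    refine ⟨(fixedField H).comap σ, fun h ↦ hB'.2 ?_, fun h ↦ ?_⟩
    · rw [h, IntermediateField.map_bot] at hmap
      have hH : H = ⊤ := by
        rw [← fixingSubgroup_fixedField H, ← hmap, IntermediateField.fixingSubgroup_bot]
      rw [← hB.orbit_stabilizer_eq hσ]
      refine Set.eq_univ_of_forall fun τ ↦ ?_
      obtain ⟨g, rfl⟩ := exists_galois_smul_eq σ τ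
      exact ⟨⟨g, by change g ∈ H; rw [hH]; trivial⟩, rfl⟩
    · rw [h, ← AlgHom.fieldRange_eq_map] at hmap
      have hH : H = stabilizer _ σ := by
        rw [stabilizer_conjugate, hmap, fixingSubgroup_fixedField]
      rw [← Set.not_subsingleton_iff] at hB'
      apply hB'.1
      rw [← hB.orbit_stabilizer_eq hσ]
      rintro _ ⟨⟨g, hg⟩, rfl⟩ _ ⟨⟨k, hk⟩, rfl⟩
      have hg' : g ∈ stabilizer _ σ := hH ▸ hg
      have hk' : k ∈ stabilizer _ σ := hH ▸ hk
      exact hg'.trans hk'.symm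
  · rintro ⟨L, hbot, htop⟩
    obtain ⟨σ⟩ : Nonempty (Conjugates F E) :=
      ⟨(IsScalarTower.toAlgHom F E (AlgebraicClosure E)).codRestrict
        (GaloisClosure F E).toSubalgebra fun x ↦
          (AlgHom.fieldRange_le_normalClosure
            (IsScalarTower.toAlgHom F E (AlgebraicClosure E))) ⟨x, rfl⟩⟩
    have hle : stabilizer _ σ ≤ (L.map σ).fixingSubgroup := by
      rw [stabilizer_conjugate]
      apply IntermediateField.fixingSubgroup_le
      rw [AlgHom.fieldRange_eq_map]
      exact IntermediateField.map_mono σ le_top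
    -- The block is the orbit of σ under Gal(K/σ(L)). The fixing groups of L and E, or of L and F,
    -- agree if it is trivial.
    refine ⟨_, IsBlock.of_orbit hle, ?_⟩
    rintro (h | h)
    · apply htop
      have hH : (L.map σ).fixingSubgroup ≤ σ.fieldRange.fixingSubgroup := by
        intro g hg
        rw [← stabilizer_conjugate]
        exact h ⟨⟨g, hg⟩, rfl⟩ (mem_orbit_self σ)
      have := fixedField_antitone hH
      rw [fixedField_fixingSubgroup, fixedField_fixingSubgroup, AlgHom.fieldRange_eq_map] at this
      rw [eq_top_iff]
      intro x hx
      obtain ⟨y, hy, hxy⟩ := this ⟨x, hx, rfl⟩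
      rwa [← σ.injective hxy]
    · apply hbot
      have hH := stabilizer_orbit_eq hle
      rw [h] at hH
      have hH' : (L.map σ).fixingSubgroup = ⊤ := by
        rw [← hH, eq_top_iff]
        intro g _
        exact Set.smul_set_univ
      have := congrArg fixedField hH'
      rw [fixedField_fixingSubgroup, ← IntermediateField.fixingSubgroup_bot,
        fixedField_fixingSubgroup] at this
      rw [← IntermediateField.map_bot σ] at this
      exact IntermediateField.map_injective σ this

end Imprimitive

/-! ### Krull dimension and transcendence degree -/

section Dimension

open Order

/-- Incomparability gives ≤; lying over and going up lift chains of primes and give ≥. -/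
theorem ringKrullDim_eq_of_isIntegral {A B : Type*} [CommRing A] [CommRing B] [Algebra A B]
    [IsDomain B] [Algebra.IsIntegral A B] [FaithfulSMul A B] : ringKrullDim B = ringKrullDim A := by
  have : IsDomain A := (FaithfulSMul.algebraMap_injective A B).isDomain
  apply le_antisymm
  · refine krullDim_le_of_strictMono (PrimeSpectrum.comap (algebraMap A B)) fun p q h ↦ ?_
    exact Ideal.IsIntegral.comap_lt_comap (I := p.asIdeal) (J := q.asIdeal) h
  · refine iSup_le fun l ↦ ?_
    obtain ⟨P, hP, hPl⟩ := Ideal.exists_ideal_over_prime_of_isIntegral_of_isDomain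
      (S := B) l.head.asIdeal (by simp [(RingHom.injective_iff_ker_eq_bot _).mp
        (FaithfulSMul.algebraMap_injective A B)])
    have : P.LiesOver l.head.asIdeal := ⟨hPl.symm⟩
    obtain ⟨l', hl', -⟩ := Ideal.exists_ltSeries_of_hasGoingUp l P
    rw [← hl']
    exact l'.length_le_krullDim

/-- Noether normalization: both invariants equal the number of variables of a polynomial ring over
which A is integral. -/
theorem exists_ringKrullDim_eq_and_trdeg_eq (k A K : Type) [Field k] [CommRing A] [IsDomain A]
    [Field K] [Algebra k A] [Algebra k K] [Algebra A K] [IsScalarTower k A K]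
    [IsFractionRing A K] [Algebra.FiniteType k A] :
    ∃ n : ℕ, ringKrullDim A = n ∧ Algebra.trdeg k K = n := by
  obtain ⟨n, g, hg, hint⟩ := exists_integral_inj_algHom_of_fg k A
  refine ⟨n, ?_, ?_⟩
  · let := g.toRingHom.toAlgebra
    have : Algebra.IsIntegral (MvPolynomial (Fin n) k) A := ⟨hint⟩
    have : FaithfulSMul (MvPolynomial (Fin n) k) A :=
      (faithfulSMul_iff_algebraMap_injective _ _).mpr hg
    rw [ringKrullDim_eq_of_isIntegral (A := MvPolynomial (Fin n) k),
      MvPolynomial.ringKrullDim_of_isNoetherianRing]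
    simp
  · let := g.toRingHom.toAlgebra
    have : Algebra.IsIntegral (MvPolynomial (Fin n) k) A := ⟨hint⟩
    have : FaithfulSMul (MvPolynomial (Fin n) k) A :=
      (faithfulSMul_iff_algebraMap_injective _ _).mpr hg
    have : IsScalarTower k (MvPolynomial (Fin n) k) A :=
      IsScalarTower.of_algebraMap_eq fun x ↦ (g.commutes x).symm
    have : FaithfulSMul A K :=
      (faithfulSMul_iff_algebraMap_injective _ _).mpr (IsFractionRing.injective A K)
    have : Algebra.IsAlgebraic A K := IsLocalization.isAlgebraic (R := A) K (nonZeroDivisors A)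
    have : FaithfulSMul k A :=
      (faithfulSMul_iff_algebraMap_injective _ _).mpr (algebraMap k A).injective
    rw [← trdeg_add_eq k A, trdeg_eq_zero (R := A), add_zero,
      ← trdeg_add_eq k (MvPolynomial (Fin n) k), trdeg_eq_zero (A := A), add_zero,
      MvPolynomial.trdeg_of_isDomain]
    simp

/-- Dimension is a supremum of coheights, and coheight is local: every irreducible closed set
containing T meets any open set that meets T. -/
theorem topologicalKrullDim_eq_of_forall_exists_opens {X : Type*} [TopologicalSpace X] [Nonempty X]
    (d : WithBot ℕ∞)
    (h : ∀ x : X, ∃ U : TopologicalSpace.Opens X, x ∈ U ∧ topologicalKrullDim U = d) :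
    topologicalKrullDim X = d := by
  apply le_antisymm
  · rw [topologicalKrullDim, krullDim_eq_iSup_coheight]
    refine iSup_le fun T ↦ ?_
    obtain ⟨x, hx⟩ := T.2.nonempty
    obtain ⟨U, hxU, hU⟩ := h x
    have hemb := U.isOpenEmbedding'
    let T' := (TopologicalSpace.IrreducibleCloseds.orderIsoOfIsOpenEmbedding _ hemb).symm
      ⟨T, ⟨⟨x, hxU⟩, hx⟩⟩
    have hT' : TopologicalSpace.IrreducibleCloseds.map _ hemb.continuous T' = T :=
      congrArg Subtype.val ((TopologicalSpace.IrreducibleCloseds.orderIsoOfIsOpenEmbedding _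
        hemb).apply_symm_apply ⟨T, ⟨⟨x, hxU⟩, hx⟩⟩)
    rw [← hT', hemb.coheight_map, ← hU]
    exact coheight_le_krullDim T'
  · obtain ⟨U, -, hU⟩ := h (Classical.arbitrary X)
    rw [← hU]
    exact topologicalKrullDim_subspace_le X U

end Dimension

/-! ### Pullback of rational functions -/

section FunctionField

variable {X Y Z : Scheme.{0}} [IsIntegral X] [IsIntegral Y] [IsIntegral Z]

theorem genericPoint_mem (U : X.Opens) [Nonempty U] : genericPoint X ∈ U :=
  ((genericPoint_spec X).mem_open_set_iff U.isOpen).mpr (by simpa using ‹Nonempty U›)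

instance nonempty_opens_top : Nonempty (⊤ : X.Opens) :=
  ⟨⟨genericPoint X, trivial⟩⟩

theorem nonempty_preimage_of_isDominant (f : X ⟶ Z) [IsDominant f] (V : Z.Opens) [Nonempty V] :
    Nonempty (f ⁻¹ᵁ V) :=
  ⟨genericPoint X, by
    change f (genericPoint X) ∈ V
    rw [genericPoint_map f]
    exact genericPoint_mem V⟩

/-- Reduces identities between pullbacks of rational functions to identities between sections. -/
theorem functionFieldPullback_germ (f : X ⟶ Z) [IsDominant f] (V : Z.Opens) [Nonempty V]
    [Nonempty (f ⁻¹ᵁ V)] (s : Γ(Z, V)) :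
    functionFieldPullback f (Z.germToFunctionField V s) =
      X.germToFunctionField (f ⁻¹ᵁ V) (f.app V s) := by
  have h : f (genericPoint X) ∈ V := by
    rw [genericPoint_map f]
    exact genericPoint_mem V
  have h₁ : Z.germToFunctionField V ≫
      Z.presheaf.stalkSpecializes (specializes_of_eq (genericPoint_map f)) ≫
        f.stalkMap (genericPoint X) = f.app V ≫ X.germToFunctionField (f ⁻¹ᵁ V) := by
    rw [← Category.assoc]
    erw [Z.presheaf.germ_stalkSpecializes]
    exact Scheme.Hom.germ_stalkMap f V _ h
  exact congrArg (fun g ↦ g.hom s) h₁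

theorem germToFunctionField_res {U V : X.Opens} (i : U ⟶ V) [Nonempty U] [Nonempty V]
    (s : Γ(X, V)) :
    X.germToFunctionField U (X.presheaf.map i.op s) = X.germToFunctionField V s :=
  X.presheaf.germ_res_apply i _ _ s

theorem exists_germToFunctionField_eq (x : X.functionField) :
    ∃ (U : X.Opens) (_ : Nonempty U) (s : Γ(X, U)), X.germToFunctionField U s = x := by
  obtain ⟨U, hU, s, hs⟩ := X.presheaf.exists_germ_eq x
  exact ⟨U, ⟨_, hU⟩, s, hs⟩

theorem functionFieldPullback_comp (f : X ⟶ Y) (g : Y ⟶ Z) [IsDominant f] [IsDominant g]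
    [IsDominant (f ≫ g)] (z : Z.functionField) :
    functionFieldPullback (f ≫ g) z = functionFieldPullback f (functionFieldPullback g z) := by
  obtain ⟨V, hV, s, rfl⟩ := exists_germToFunctionField_eq z
  have := nonempty_preimage_of_isDominant g V
  have := nonempty_preimage_of_isDominant f (g ⁻¹ᵁ V)
  have : Nonempty ((f ≫ g) ⁻¹ᵁ V) := this
  rw [functionFieldPullback_germ, functionFieldPullback_germ, functionFieldPullback_germ]
  simp
  rfl

theorem functionFieldPullback_congr {f g : X ⟶ Z} (h : f = g) [IsDominant f] [IsDominant g]
    (z : Z.functionField) : functionFieldPullback f z = functionFieldPullback g z := by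
  subst h
  rfl

theorem functionFieldPullback_surjective_of_isOpenImmersion (f : X ⟶ Z) [IsDominant f]
    [IsOpenImmersion f] : Function.Surjective (functionFieldPullback f) := by
  intro x
  obtain ⟨U, hU, s, rfl⟩ := exists_germToFunctionField_eq x
  have : Nonempty (f ''ᵁ U) := ⟨f hU.some.1, Set.mem_image_of_mem _ hU.some.2⟩
  have : Nonempty (f ⁻¹ᵁ f ''ᵁ U) := nonempty_preimage_of_isDominant f _
  refine ⟨Z.germToFunctionField (f ''ᵁ U) ((f.appIso U).inv s), ?_⟩
  rw [functionFieldPullback_germ]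
  have h : f.app (f ''ᵁ U) ((f.appIso U).inv s) =
      X.presheaf.map (eqToHom (f.preimage_image_eq U)).op s :=
    congrArg (fun g ↦ g.hom s) (f.appIso_inv_app U)
  rw [h, germToFunctionField_res]

theorem mapDegree_eq_one_iff (f : X ⟶ Z) [IsDominant f] :
    mapDegree f = 1 ↔ Function.Surjective (functionFieldPullback f) := by
  change _ ↔ Function.Surjective (algebraMap Z.functionField (SourceField f))
  constructor
  · intro h x
    obtain ⟨c, hc⟩ := (finrank_eq_one_iff_of_nonzero' (1 : SourceField f) one_ne_zero).mp h x
    exact ⟨c, by rw [← hc, Algebra.smul_def, mul_one]⟩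
  · intro h
    refine (finrank_eq_one_iff_of_nonzero' (1 : SourceField f) one_ne_zero).mpr fun x ↦ ?_
    obtain ⟨c, rfl⟩ := h x
    exact ⟨c, by rw [Algebra.smul_def, mul_one]⟩

end FunctionField

/-! ### Function fields over ℂ: dimension and finiteness -/

section ComplexFunctionField

/-- The inclusion of the constants into the function field of a scheme over `ℂ`. -/
noncomputable def functionFieldScalars (X : Scheme.{0}) [IsIntegral X] [X.Over SpecC] :
    ℂ →+* X.functionField :=
  (X.germToFunctionField ⊤).hom.comp
    ((X ↘ SpecC).appTop.hom.comp (Scheme.ΓSpecIso (CommRingCat.of ℂ)).inv.hom)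

variable {X Z : Scheme.{0}} [X.Over SpecC] [Z.Over SpecC] [IsIntegral X] [IsIntegral Z]

theorem functionFieldPullback_scalars (f : X ⟶ Z) [IsDominant f] [f.IsOver SpecC] (c : ℂ) :
    functionFieldPullback f (functionFieldScalars Z c) = functionFieldScalars X c := by
  have : Nonempty (f ⁻¹ᵁ (⊤ : Z.Opens)) := nonempty_preimage_of_isDominant f ⊤
  change functionFieldPullback f (Z.germToFunctionField ⊤ ((Z ↘ SpecC).appTop _)) =
    X.germToFunctionField ⊤ ((X ↘ SpecC).appTop _)
  rw [functionFieldPullback_germ]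
  have h : (Z ↘ SpecC).appTop ≫ f.appTop = (X ↘ SpecC).appTop := by
    rw [← Scheme.Hom.comp_appTop, comp_over]
  rw [← h]
  rfl

/-- The coordinate ring of an affine open, as a `ℂ`-algebra of finite type inside the function
field. -/
theorem exists_affine_model (U : X.Opens) (hU : IsAffineOpen U) [Nonempty U]
    [LocallyOfFiniteType (X ↘ SpecC)] :
    ∃ φ : ℂ →+* Γ(X, U), φ.FiniteType ∧
      (X.germToFunctionField U).hom.comp φ = functionFieldScalars X := by
  refine ⟨((X ↘ SpecC).appLE ⊤ U le_top).hom.comp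
    (Scheme.ΓSpecIso (CommRingCat.of ℂ)).inv.hom, ?_, ?_⟩
  · refine RingHom.FiniteType.comp
      (LocallyOfFiniteType.finiteType_appLE (X ↘ SpecC) (isAffineOpen_top _) hU le_top) ?_
    exact RingHom.FiniteType.of_surjective _
      (ConcreteCategory.bijective_of_isIso (Scheme.ΓSpecIso (CommRingCat.of ℂ)).inv).2
  · ext c
    change X.germToFunctionField U ((X ↘ SpecC).appLE ⊤ U le_top _) =
      X.germToFunctionField ⊤ ((X ↘ SpecC).appTop _)
    exact germToFunctionField_res (homOfLE le_top) _

theorem exists_topologicalKrullDim_eq_and_trdeg_eq [LocallyOfFiniteType (X ↘ SpecC)] :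
    letI := (functionFieldScalars X).toAlgebra
    ∃ n : ℕ, topologicalKrullDim X = n ∧ Algebra.trdeg ℂ X.functionField = n := by
  let := (functionFieldScalars X).toAlgebra
  have key (U : X.Opens) (hU : IsAffineOpen U) [Nonempty U] :
      ∃ n : ℕ, topologicalKrullDim U = n ∧ Algebra.trdeg ℂ X.functionField = n := by
    obtain ⟨φ, hφ, hcomp⟩ := exists_affine_model U hU
    let := φ.toAlgebra
    have : Algebra.FiniteType ℂ Γ(X, U) := hφ
    have : IsScalarTower ℂ Γ(X, U) X.functionField :=
      IsScalarTower.of_algebraMap_eq fun c ↦ (DFunLike.congr_fun hcomp c).symm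
    have := functionField_isFractionRing_of_isAffineOpen X U hU
    obtain ⟨n, hn, hn'⟩ := exists_ringKrullDim_eq_and_trdeg_eq ℂ Γ(X, U) X.functionField
    refine ⟨n, ?_, hn'⟩
    rw [← hn, ← PrimeSpectrum.topologicalKrullDim_eq_ringKrullDim]
    exact IsHomeomorph.topologicalKrullDim_eq _ (hU.isoSpec.hom.homeomorph.isHomeomorph)
  obtain ⟨U, hU, hxU, -⟩ := X.isBasis_affineOpens.exists_subset_of_mem_open
    (Set.mem_univ (genericPoint X)) isOpen_univ
  obtain ⟨U, hU', rfl⟩ := hU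
  have : Nonempty U := ⟨_, hxU⟩
  obtain ⟨n, -, hn⟩ := key U hU'
  refine ⟨n, topologicalKrullDim_eq_of_forall_exists_opens _ fun x ↦ ?_, hn⟩
  obtain ⟨V, hV, hxV, -⟩ := X.isBasis_affineOpens.exists_subset_of_mem_open
    (Set.mem_univ x) isOpen_univ
  obtain ⟨V, hV', rfl⟩ := hV
  have : Nonempty V := ⟨_, hxV⟩
  obtain ⟨m, hm, hm'⟩ := key V hV'
  refine ⟨V, hxV, ?_⟩
  rw [hn] at hm'
  rw [Nat.cast_inj.mp hm']
  exact hm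

theorem topologicalKrullDim_eq_iff_isAlgebraic [LocallyOfFiniteType (X ↘ SpecC)]
    [LocallyOfFiniteType (Z ↘ SpecC)] (f : X ⟶ Z) [IsDominant f] [f.IsOver SpecC] :
    topologicalKrullDim X = topologicalKrullDim Z ↔
      Algebra.IsAlgebraic Z.functionField (SourceField f) := by
  obtain ⟨n, hn, hn'⟩ := exists_topologicalKrullDim_eq_and_trdeg_eq (X := X)
  obtain ⟨m, hm, hm'⟩ := exists_topologicalKrullDim_eq_and_trdeg_eq (X := Z)
  let : Algebra ℂ (SourceField f) := (functionFieldScalars X).toAlgebra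
  let := (functionFieldScalars Z).toAlgebra
  have : IsScalarTower ℂ Z.functionField (SourceField f) :=
    IsScalarTower.of_algebraMap_eq fun c ↦ (functionFieldPullback_scalars f c).symm
  have hadd := trdeg_add_eq ℂ Z.functionField (A := SourceField f)
  change Algebra.trdeg ℂ (SourceField f) = n at hn'
  rw [hn', hm'] at hadd
  rw [hn, hm, ← trdeg_eq_zero_iff]
  constructor
  · intro h
    have h : n = m := by exact_mod_cast h
    subst h
    -- Transcendence degrees are cardinals; cancelling n is legitimate because n is finite.
    exact Cardinal.eq_of_add_eq_add_left (a := (n : Cardinal)) (by rw [hadd, add_zero])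
      (Cardinal.natCast_lt_aleph0)
  · intro h
    rw [h, add_zero] at hadd
    have h : m = n := by exact_mod_cast hadd
    rw [h]

theorem finiteDimensional_sourceField [LocallyOfFiniteType (X ↘ SpecC)]
    (f : X ⟶ Z) [IsDominant f] [f.IsOver SpecC]
    [Algebra.IsAlgebraic Z.functionField (SourceField f)] :
    FiniteDimensional Z.functionField (SourceField f) := by
  let : Algebra ℂ (SourceField f) := (functionFieldScalars X).toAlgebra
  let := (functionFieldScalars Z).toAlgebra
  have : IsScalarTower ℂ Z.functionField (SourceField f) :=
    IsScalarTower.of_algebraMap_eq fun c ↦ (functionFieldPullback_scalars f c).symm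
  obtain ⟨U, hU, hxU, -⟩ := X.isBasis_affineOpens.exists_subset_of_mem_open
    (Set.mem_univ (genericPoint X)) isOpen_univ
  obtain ⟨U, hU', rfl⟩ := hU
  have : Nonempty U := ⟨_, hxU⟩
  obtain ⟨φ, hφ, hcomp⟩ := exists_affine_model U hU'
  let := φ.toAlgebra
  let : Algebra Γ(X, U) (SourceField f) := (X.germToFunctionField U).hom.toAlgebra
  have : Algebra.FiniteType ℂ Γ(X, U) := hφ
  have : IsScalarTower ℂ Γ(X, U) (SourceField f) :=
    IsScalarTower.of_algebraMap_eq fun c ↦ (DFunLike.congr_fun hcomp c).symm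
  have : IsFractionRing Γ(X, U) (SourceField f) :=
    functionField_isFractionRing_of_isAffineOpen X U hU'
  have : Algebra.EssFiniteType Γ(X, U) (SourceField f) :=
    .of_isLocalization _ (nonZeroDivisors Γ(X, U))
  have : Algebra.EssFiniteType ℂ (SourceField f) := .comp ℂ Γ(X, U) _
  have : Algebra.EssFiniteType Z.functionField (SourceField f) := .of_comp ℂ _ _
  exact Algebra.finite_of_essFiniteType_of_isAlgebraic

theorem charZero_functionField : CharZero X.functionField :=
  charZero_of_injective_ringHom (functionFieldScalars X).injective

end ComplexFunctionField

/-! ### From factorizations to subfields, and clearing denominators -/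

section Extension

variable {X Y Z : Scheme.{0}} [IsIntegral X] [IsIntegral Y] [IsIntegral Z]

theorem isAlgebraic_of_isOpenImmersion (f : X ⟶ Z) [IsDominant f] [IsOpenImmersion f] :
    Algebra.IsAlgebraic Z.functionField (SourceField f) :=
  ⟨fun x ↦ by
    obtain ⟨z, rfl⟩ := functionFieldPullback_surjective_of_isOpenImmersion f x
    exact isAlgebraic_algebraMap (A := SourceField f) z⟩

theorem isAlgebraic_of_comp (f : X ⟶ Y) (g : Y ⟶ Z) [IsDominant f] [IsDominant g]
    [IsDominant (f ≫ g)] (h : Algebra.IsAlgebraic Z.functionField (SourceField (f ≫ g))) :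
    Algebra.IsAlgebraic Y.functionField (SourceField f) ∧
      Algebra.IsAlgebraic Z.functionField (SourceField g) := by
  let : Algebra Z.functionField Y.functionField := (functionFieldPullback g).toAlgebra
  let : Algebra Y.functionField X.functionField := (functionFieldPullback f).toAlgebra
  let : Algebra Z.functionField X.functionField := (functionFieldPullback (f ≫ g)).toAlgebra
  have : IsScalarTower Z.functionField Y.functionField X.functionField :=
    IsScalarTower.of_algebraMap_eq (functionFieldPullback_comp f g)
  have h' : Algebra.IsAlgebraic Z.functionField X.functionField := h
  exact ⟨Algebra.IsAlgebraic.tower_top (K := Z.functionField) (L := Y.functionField)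
    (A := X.functionField), Algebra.IsAlgebraic.tower_bot Z.functionField Y.functionField
    X.functionField⟩

theorem isDominant_opens_ι (U : X.Opens) [Nonempty U] : IsDominant U.ι :=
  AlgebraicGeometry.Opens.isDominant_ι (U.isOpen.dense ⟨_, genericPoint_mem U⟩)

theorem exists_intermediateField_of_factorization (f : X ⟶ Z) [IsDominant f] (V : Z.Opens)
    [IsIntegral (f ⁻¹ᵁ V).toScheme] [IsIntegral V.toScheme] [IsDominant (f ⁻¹ᵁ V).ι]
    [IsDominant V.ι] (φ : (f ⁻¹ᵁ V).toScheme ⟶ Y) (ψ : Y ⟶ V.toScheme) [IsDominant φ]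
    [IsDominant ψ] (hf : φ ≫ ψ = f ∣_ V) (hφ : ¬ Function.Surjective (functionFieldPullback φ))
    (hψ : ¬ Function.Surjective (functionFieldPullback ψ)) :
    ∃ L : IntermediateField Z.functionField (SourceField f), L ≠ ⊥ ∧ L ≠ ⊤ := by
  let j : SourceField f →+* (f ⁻¹ᵁ V).toScheme.functionField :=
    functionFieldPullback (f ⁻¹ᵁ V).ι
  have hj (x) : ∃ y, j y = x :=
    functionFieldPullback_surjective_of_isOpenImmersion (f ⁻¹ᵁ V).ι x
  have hcomp : (f ⁻¹ᵁ V).ι ≫ f = φ ≫ ψ ≫ V.ι := by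
    rw [reassoc_of% hf, morphismRestrict_ι]
  have hbase (z : Z.functionField) : j (algebraMap _ (SourceField f) z) =
      functionFieldPullback φ (functionFieldPullback ψ (functionFieldPullback V.ι z)) := by
    rw [← functionFieldPullback_comp ψ V.ι, ← functionFieldPullback_comp φ (ψ ≫ V.ι),
      ← functionFieldPullback_congr hcomp, functionFieldPullback_comp]
    rfl
  -- L is the image of ℂ(Y), carried back to ℂ(X) along the isomorphism j.
  let L : IntermediateField Z.functionField (SourceField f) :=
    ((functionFieldPullback φ).fieldRange.comap j).toIntermediateField fun z ↦
      ⟨_, (hbase z).symm⟩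
  have hL (x : SourceField f) : x ∈ L ↔ ∃ y, functionFieldPullback φ y = j x := Iff.rfl
  refine ⟨L, fun h ↦ hψ fun y ↦ ?_, fun h ↦ hφ fun u ↦ ?_⟩
  · obtain ⟨x, hx⟩ := hj (functionFieldPullback φ y)
    have hxL : x ∈ L := ⟨y, hx.symm⟩
    rw [h, IntermediateField.mem_bot] at hxL
    obtain ⟨z, rfl⟩ := hxL
    exact ⟨_, (functionFieldPullback φ).injective ((hbase z).symm.trans hx)⟩
  · obtain ⟨x, rfl⟩ := hj u
    have hxL : x ∈ L := h ▸ trivial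
    exact hxL

/-- Local sections representing the same rational function agree on overlaps, since sections of an
integral scheme inject into its function field; hence they glue. -/
theorem exists_section_of_forall_exists_germ (U : X.Opens) [Nonempty U] (b : X.functionField)
    (h : ∀ x ∈ U, ∃ (V : X.Opens) (_ : Nonempty V) (s : Γ(X, V)), x ∈ V ∧ V ≤ U ∧
      X.germToFunctionField V s = b) :
    ∃ s : Γ(X, U), X.germToFunctionField U s = b := by
  choose V hV s hxV hVU hs using h
  obtain ⟨t, ht, -⟩ := X.sheaf.existsUnique_gluing' (fun x : U ↦ V x.1 x.2) U
    (fun x ↦ homOfLE (hVU x.1 x.2)) (fun x hx ↦ TopologicalSpace.Opens.mem_iSup.mpr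
      ⟨⟨x, hx⟩, hxV x hx⟩) (fun x ↦ s x.1 x.2) (fun x y ↦ by
      have : Nonempty (V x.1 x.2 ⊓ V y.1 y.2 : X.Opens) :=
        ⟨⟨_, genericPoint_mem (V x.1 x.2), genericPoint_mem (V y.1 y.2)⟩⟩
      apply X.germToFunctionField_injective (V x.1 x.2 ⊓ V y.1 y.2)
      exact (germToFunctionField_res _ _).trans ((hs _ _).trans
        ((germToFunctionField_res _ _).trans (hs _ _)).symm))
  refine ⟨t, ?_⟩
  let x : U := ⟨_, genericPoint_mem U⟩
  rw [← hs x.1 x.2, ← ht x]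
  exact (germToFunctionField_res _ _).symm

/-- Write b = c/e. The denominator e is algebraic over Γ(Z, W), so it divides a nonzero element a of
Γ(Z, W), and ab is regular on U. -/
theorem exists_ne_zero_mul_mem_range_germ (f : X ⟶ Z) [IsDominant f]
    [Algebra.IsAlgebraic Z.functionField (SourceField f)] (W : Z.Opens) (hW : IsAffineOpen W)
    [Nonempty W] (U : X.Opens) (hU : IsAffineOpen U) [Nonempty U] (hUW : U ≤ f ⁻¹ᵁ W)
    (b : X.functionField) :
    ∃ a : Γ(Z, W), a ≠ 0 ∧ ∃ s : Γ(X, U), X.germToFunctionField U s =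
      functionFieldPullback f (Z.germToFunctionField W a) * b := by
  have := nonempty_preimage_of_isDominant f W
  let : Algebra Γ(Z, W) Γ(X, U) := (f.appLE W U hUW).hom.toAlgebra
  let : Algebra Z.functionField X.functionField := (functionFieldPullback f).toAlgebra
  let : Algebra Γ(Z, W) X.functionField :=
    ((functionFieldPullback f).comp (Z.germToFunctionField W).hom).toAlgebra
  have : IsScalarTower Γ(Z, W) Z.functionField X.functionField :=
    IsScalarTower.of_algebraMap_eq fun _ ↦ rfl
  have hgerm (a : Γ(Z, W)) : functionFieldPullback f (Z.germToFunctionField W a) =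
      X.germToFunctionField U (f.appLE W U hUW a) := by
    rw [functionFieldPullback_germ]
    exact (germToFunctionField_res (homOfLE hUW) (f.app W a)).symm
  have : IsScalarTower Γ(Z, W) Γ(X, U) X.functionField :=
    IsScalarTower.of_algebraMap_eq hgerm
  have := functionField_isFractionRing_of_isAffineOpen Z W hW
  have := functionField_isFractionRing_of_isAffineOpen X U hU
  obtain ⟨c, e, he, rfl⟩ := IsFractionRing.div_surjective Γ(X, U) b
  have halg : Algebra.IsAlgebraic Z.functionField X.functionField :=
    inferInstanceAs (Algebra.IsAlgebraic Z.functionField (SourceField f))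
  have he' : IsAlgebraic Γ(Z, W) (algebraMap Γ(X, U) X.functionField e) :=
    (IsFractionRing.isAlgebraic_iff Γ(Z, W) Z.functionField X.functionField).mpr
      (halg.isAlgebraic _)
  rw [isAlgebraic_algebraMap_iff (IsFractionRing.injective Γ(X, U) X.functionField)] at he'
  obtain ⟨a, ha, d, hd⟩ := he'.exists_nonzero_dvd he
  refine ⟨a, ha, d * c, ?_⟩
  have he0 : algebraMap Γ(X, U) X.functionField e ≠ 0 :=
    IsFractionRing.to_map_ne_zero_of_mem_nonZeroDivisors he
  rw [hgerm]
  change algebraMap Γ(X, U) X.functionField _ =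
    algebraMap Γ(X, U) X.functionField (algebraMap Γ(Z, W) Γ(X, U) a) * _
  rw [hd, map_mul, map_mul]
  field_simp

/-- By compactness finitely many affine opens suffice; the product of their denominators works for
all of them, and the local sections glue. -/
theorem exists_ne_zero_mul_mem_range_germ_preimage (f : X ⟶ Z) [IsDominant f]
    [Algebra.IsAlgebraic Z.functionField (SourceField f)] (W : Z.Opens) (hW : IsAffineOpen W)
    [Nonempty W] [Nonempty (f ⁻¹ᵁ W)] (hc : IsCompact (f ⁻¹ᵁ W : Set X))
    (b : X.functionField) :
    ∃ a : Γ(Z, W), a ≠ 0 ∧ ∃ s : Γ(X, f ⁻¹ᵁ W), X.germToFunctionField (f ⁻¹ᵁ W) s =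
      functionFieldPullback f (Z.germToFunctionField W a) * b := by
  suffices h : ∃ a : Γ(Z, W), a ≠ 0 ∧ ∀ x ∈ (f ⁻¹ᵁ W : Set X),
      ∃ (V : X.Opens) (_ : Nonempty V) (s : Γ(X, V)), x ∈ V ∧ V ≤ f ⁻¹ᵁ W ∧
        X.germToFunctionField V s =
          functionFieldPullback f (Z.germToFunctionField W a) * b by
    obtain ⟨a, ha, h⟩ := h
    exact ⟨a, ha, exists_section_of_forall_exists_germ _ _ h⟩
  have key (a a' : Γ(Z, W)) (x : X) (h : ∃ (V : X.Opens) (_ : Nonempty V) (s : Γ(X, V)),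
      x ∈ V ∧ V ≤ f ⁻¹ᵁ W ∧ X.germToFunctionField V s =
        functionFieldPullback f (Z.germToFunctionField W a) * b) :
      ∃ (V : X.Opens) (_ : Nonempty V) (s : Γ(X, V)), x ∈ V ∧ V ≤ f ⁻¹ᵁ W ∧
        X.germToFunctionField V s =
          functionFieldPullback f (Z.germToFunctionField W (a' * a)) * b := by
    obtain ⟨V, hV, s, hx, hVW, hs⟩ := h
    refine ⟨V, hV, f.appLE W V hVW a' * s, hx, hVW, ?_⟩
    rw [map_mul, map_mul, map_mul, mul_assoc, ← hs, functionFieldPullback_germ]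
    congr 1
    exact germToFunctionField_res (homOfLE hVW) (f.app W a')
  refine hc.induction_on (p := fun S ↦ ∃ a : Γ(Z, W), a ≠ 0 ∧ ∀ x ∈ S,
      ∃ (V : X.Opens) (_ : Nonempty V) (s : Γ(X, V)), x ∈ V ∧ V ≤ f ⁻¹ᵁ W ∧
        X.germToFunctionField V s =
          functionFieldPullback f (Z.germToFunctionField W a) * b) ?_ ?_ ?_ ?_
  · exact ⟨1, one_ne_zero, by simp⟩
  · rintro S T hST ⟨a, ha, h⟩
    exact ⟨a, ha, fun x hx ↦ h x (hST hx)⟩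
  · rintro S T ⟨a, ha, h⟩ ⟨a', ha', h'⟩
    refine ⟨a * a', mul_ne_zero ha ha', ?_⟩
    rintro x (hx | hx)
    · rw [mul_comm a a']
      exact key a a' x (h x hx)
    · exact key a' a x (h' x hx)
  · intro x hx
    obtain ⟨_, ⟨U, hU, rfl⟩, hxU, hUW⟩ :=
      X.isBasis_affineOpens.exists_subset_of_mem_open hx (f ⁻¹ᵁ W).isOpen
    have : Nonempty U := ⟨_, hxU⟩
    obtain ⟨a, ha, s, hs⟩ := exists_ne_zero_mul_mem_range_germ f W hW U hU hUW b
    exact ⟨U, mem_nhdsWithin_of_mem_nhds (U.isOpen.mem_nhds hxU), a, ha,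
      fun y hy ↦ ⟨U, ‹_›, s, hy, hUW, hs⟩⟩

end Extension

/-! ### From subfields to factorizations -/

section Factorization

variable {X Z : Scheme.{0}} [IsIntegral X]

theorem functionFieldPullback_algebraMap (R : CommRingCat.{0}) [IsDomain R] (U : X.Opens)
    [Nonempty U] [IsIntegral U.toScheme] [IsDominant U.ι] (ι : R ⟶ Γ(X, U))
    [IsDominant (U.toSpecΓ ≫ Spec.map ι)] (c : R) :
    functionFieldPullback (U.toSpecΓ ≫ Spec.map ι) (algebraMap R _ c) =
      functionFieldPullback U.ι (X.germToFunctionField U (ι c)) := by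
  have : Nonempty (U.ι ⁻¹ᵁ U) := nonempty_preimage_of_isDominant _ _
  have : Nonempty ((U.toSpecΓ ≫ Spec.map ι) ⁻¹ᵁ ⊤) := nonempty_preimage_of_isDominant _ _
  have h : algebraMap R (Spec R).functionField c =
      (Spec R).germToFunctionField ⊤ ((Scheme.ΓSpecIso R).inv c) := rfl
  rw [h, functionFieldPullback_germ, functionFieldPullback_germ]
  have h' : (Scheme.ΓSpecIso R).inv ≫ (U.toSpecΓ ≫ Spec.map ι).appTop = ι ≫ U.topIso.inv := by
    rw [Scheme.Hom.comp_appTop, Scheme.Opens.toSpecΓ_appTop, Scheme.ΓSpecIso_naturality_assoc,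
      Iso.inv_hom_id_assoc]
  have h'' : (U.toSpecΓ ≫ Spec.map ι).appTop ((Scheme.ΓSpecIso R).inv c) =
    U.topIso.inv (ι c) := congrArg (fun g ↦ g.hom c) h'
  refine (congrArg (U.toScheme.germToFunctionField ⊤) h'').trans ?_
  rw [← germToFunctionField_res (homOfLE le_top : U.ι ⁻¹ᵁ U ⟶ ⊤)]
  congr 1
  have h₃ : U.topIso.inv ≫ U.toScheme.presheaf.map (homOfLE le_top : U.ι ⁻¹ᵁ U ⟶ ⊤).op =
      U.ι.app U := by
    rw [Scheme.Opens.ι_app]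
    exact (X.presheaf.map_comp _ _).symm
  exact congrArg (fun g ↦ g.hom (ι c)) h₃

/-- A factorization of the ring homomorphism `Γ(Z, W) ⟶ Γ(X, f ⁻¹ᵁ W)` gives a factorization of `f`
over the affine open `W`. -/
theorem exists_factorization_of_ringHom (f : X ⟶ Z) [IsDominant f] (W : Z.Opens)
    (hW : IsAffineOpen W) [Nonempty W] [Nonempty (f ⁻¹ᵁ W)] [CompactSpace (f ⁻¹ᵁ W).toScheme]
    [IsIntegral (f ⁻¹ᵁ W).toScheme]
    [IsDominant (f ⁻¹ᵁ W).ι] (R : CommRingCat.{0}) [IsDomain R] (α : Γ(Z, W) ⟶ R)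
    (ι : R ⟶ Γ(X, f ⁻¹ᵁ W)) (hαι : α ≫ ι = f.app W) (hα : α.hom.FiniteType)
    (hinj : Function.Injective ι) :
    ∃ (φ : (f ⁻¹ᵁ W).toScheme ⟶ Spec R) (ψ : Spec R ⟶ W.toScheme)
      (_ : IsDominant φ), φ ≫ ψ = f ∣_ W ∧ IsDominant ψ ∧ IsAffineHom ψ ∧
      LocallyOfFiniteType ψ ∧
      ∀ c : R, functionFieldPullback φ (algebraMap R _ c) =
        functionFieldPullback (f ⁻¹ᵁ W).ι (X.germToFunctionField (f ⁻¹ᵁ W) (ι c)) := by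
  let φ : (f ⁻¹ᵁ W).toScheme ⟶ Spec R := (f ⁻¹ᵁ W).toSpecΓ ≫ Spec.map ι
  let ψ : Spec R ⟶ W.toScheme := Spec.map α ≫ hW.isoSpec.inv
  have hcomp : φ ≫ ψ = f ∣_ W := by
    simp only [φ, ψ, Category.assoc]
    rw [← Spec.map_comp_assoc, hαι, reassoc_of% Scheme.Opens.toSpecΓ_naturality f W,
      hW.toSpecΓ_isoSpec_inv, Category.comp_id]
  -- An injective ring map has dense image on spectra.
  have hι : IsDominant (Spec.map ι) := by
    refine ⟨?_⟩
    have : DenseRange (PrimeSpectrum.comap ι.hom) := by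
      rw [PrimeSpectrum.denseRange_comap_iff_ker_le_nilRadical,
        (RingHom.injective_iff_ker_eq_bot _).mp hinj]
      exact bot_le
    exact this
  have hφ : IsDominant φ := by
    have : IsDominant (f ⁻¹ᵁ W).toSpecΓ := by
      rw [Scheme.Opens.toSpecΓ]
      infer_instance
    infer_instance
  have hfW : IsDominant (f ∣_ W) := IsZariskiLocalAtTarget.restrict ‹_› W
  have hψ : IsDominant ψ := by
    rw [← hcomp] at hfW
    exact IsDominant.of_comp φ ψ
  refine ⟨φ, ψ, hφ, hcomp, hψ, inferInstance, ?_, fun c ↦ ?_⟩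
  · have : LocallyOfFiniteType (Spec.map α) := by
      rw [HasRingHomProperty.Spec_iff (P := @LocallyOfFiniteType)]
      exact hα
    infer_instance
  · exact functionFieldPullback_algebraMap R (f ⁻¹ᵁ W) ι c

theorem exists_factorization_of_intermediateField [IsIntegral Z] (f : X ⟶ Z) [IsDominant f]
    [FiniteDimensional Z.functionField (SourceField f)] [CharZero Z.functionField]
    (L : IntermediateField Z.functionField (SourceField f)) (hbot : L ≠ ⊥) (htop : L ≠ ⊤)
    (W : Z.Opens)
    (hW : IsAffineOpen W) [Nonempty W] [Nonempty (f ⁻¹ᵁ W)] [CompactSpace (f ⁻¹ᵁ W).toScheme]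
    [IsIntegral (f ⁻¹ᵁ W).toScheme] [IsIntegral W.toScheme]
    [IsDominant (f ⁻¹ᵁ W).ι] [IsDominant W.ι] :
    ∃ (R : CommRingCat.{0}) (_ : IsDomain R) (φ : (f ⁻¹ᵁ W).toScheme ⟶ Spec R)
      (ψ : Spec R ⟶ W.toScheme) (_ : IsDominant φ) (_ : IsDominant ψ),
      φ ≫ ψ = f ∣_ W ∧ IsAffineHom ψ ∧ LocallyOfFiniteType ψ ∧
      ¬ Function.Surjective (functionFieldPullback φ) ∧
      ¬ Function.Surjective (functionFieldPullback ψ) := by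
  obtain ⟨β, hβ⟩ := Field.exists_primitive_element Z.functionField L
  have hβL : IntermediateField.adjoin Z.functionField {(β : SourceField f)} = L := by
    have := congrArg IntermediateField.lift hβ
    rwa [IntermediateField.lift_adjoin_simple, IntermediateField.lift_top] at this
  obtain ⟨a, ha, s, hs⟩ := exists_ne_zero_mul_mem_range_germ_preimage f W hW
    (isCompact_iff_compactSpace.mpr ‹_›) (β : SourceField f)
  let germ : Γ(X, f ⁻¹ᵁ W) →+* SourceField f := (X.germToFunctionField (f ⁻¹ᵁ W)).hom
  have hgerm (t : Γ(Z, W)) : germ (f.app W t) =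
      algebraMap Z.functionField (SourceField f) (Z.germToFunctionField W t) :=
    (functionFieldPullback_germ f W t).symm
  have hs' : germ s =
      algebraMap Z.functionField (SourceField f) (Z.germToFunctionField W a) * β := hs
  let := (f.app W).hom.toAlgebra
  let B : Subalgebra Γ(Z, W) Γ(X, f ⁻¹ᵁ W) := Algebra.adjoin Γ(Z, W) {s}
  have hB (c : Γ(X, f ⁻¹ᵁ W)) (hc : c ∈ B) : germ c ∈ L := by
    induction hc using Algebra.adjoin_induction with
    | mem x hx =>
      obtain rfl := hx
      rw [hs']
      exact mul_mem (L.algebraMap_mem _) β.2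
    | algebraMap r =>
      refine (hgerm r).symm ▸ L.algebraMap_mem _
    | add x y _ _ hx hy =>
      rw [map_add]
      exact add_mem hx hy
    | mul x y _ _ hx hy =>
      rw [map_mul]
      exact mul_mem hx hy
  obtain ⟨R, hdom, α, ι, hαι, hα, hinj, hιL, c₀, hc₀⟩ : ∃ (R : CommRingCat.{0}) (_ : IsDomain R)
      (α : Γ(Z, W) ⟶ R) (ι : R ⟶ Γ(X, f ⁻¹ᵁ W)), α ≫ ι = f.app W ∧ α.hom.FiniteType ∧
      Function.Injective ι ∧ (∀ c, germ (ι c) ∈ L) ∧ ∃ c, ι c = s :=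
    ⟨.of B, inferInstanceAs (IsDomain B), CommRingCat.ofHom (algebraMap Γ(Z, W) B),
      CommRingCat.ofHom B.val.toRingHom, rfl,
      (Subalgebra.fg_iff_finiteType B).mp ⟨{s}, by simp [B]⟩,
      Subtype.val_injective, fun c ↦ hB _ c.2, ⟨s, Algebra.subset_adjoin rfl⟩, rfl⟩
  obtain ⟨φ, ψ, hφ, hcomp, hψ, haff, hft, hc⟩ :=
    exists_factorization_of_ringHom f W hW R α ι hαι hα hinj
  let j : SourceField f →+* (f ⁻¹ᵁ W).toScheme.functionField :=
    functionFieldPullback (f ⁻¹ᵁ W).ι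
  replace hc (c : R) : functionFieldPullback φ (algebraMap R _ c) = j (germ (ι c)) := hc c
  have hcomp' : (f ⁻¹ᵁ W).ι ≫ f = φ ≫ ψ ≫ W.ι := by
    rw [reassoc_of% hcomp, morphismRestrict_ι]
  refine ⟨_, hdom, φ, ψ, hφ, hψ, hcomp, haff, hft, fun h ↦ htop ?_, fun h ↦ hbot ?_⟩
  -- Elements of ℂ(Spec R) are fractions of elements of R, all of which lie in L; so a surjective
  -- pullback along φ forces L to be everything.
  · rw [eq_top_iff]
    intro x _
    obtain ⟨y, hy⟩ := h (j x)
    obtain ⟨c, d, hd, rfl⟩ := IsFractionRing.div_surjective R y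
    rw [map_div₀, hc, hc, ← map_div₀] at hy
    rw [← j.injective hy]
    exact div_mem (hιL c) (hιL d)
  -- If ψ had surjective pullback, s = aβ would come from ℂ(Z), hence so would β = s/a, and L would
  -- be ℂ(Z).
  · obtain ⟨w, hw⟩ := h (algebraMap R _ c₀)
    obtain ⟨z, rfl⟩ := functionFieldPullback_surjective_of_isOpenImmersion W.ι w
    have h₁ : j (germ s) = j (algebraMap Z.functionField (SourceField f) z) := by
      rw [← hc₀, ← hc, ← hw, ← functionFieldPullback_comp ψ W.ι,
        ← functionFieldPullback_comp φ (ψ ≫ W.ι), ← functionFieldPullback_congr hcomp',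
        functionFieldPullback_comp]
      rfl
    replace h₁ := j.injective h₁
    have ha' : Z.germToFunctionField W a ≠ 0 := fun h0 ↦ ha
      (Z.germToFunctionField_injective W (h0.trans (map_zero _).symm))
    rw [← hβL, IntermediateField.adjoin_simple_eq_bot_iff, IntermediateField.mem_bot]
    refine ⟨z / Z.germToFunctionField W a, ?_⟩
    rw [map_div₀, ← h₁, hs', mul_div_cancel_left₀]
    exact (map_ne_zero _).mpr ha'

end Factorization

/-! ### Branched covers of complex varieties -/

section BranchedCover

variable {X Z : Scheme.{0}} [X.Over SpecC] [Z.Over SpecC]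

theorem IsComplexVariety.isLocallyNoetherian (X : Scheme.{0}) [X.Over SpecC]
    [IsComplexVariety X] : IsLocallyNoetherian X :=
  have := IsComplexVariety.locallyOfFiniteType (X := X)
  LocallyOfFiniteType.isLocallyNoetherian (X ↘ SpecC)

theorem IsComplexVariety.opens {X : Scheme.{0}} [X.Over SpecC] [IsComplexVariety X] (U : X.Opens)
    [Nonempty U] : IsComplexVariety U.toScheme := by
  have := IsComplexVariety.isIntegral (X := X)
  have := IsComplexVariety.isSeparated (X := X)
  have := IsComplexVariety.locallyOfFiniteType (X := X)
  have := IsComplexVariety.quasiCompact (X := X)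
  have := IsComplexVariety.isLocallyNoetherian X
  refine ⟨inferInstance, ?_, ?_, ?_⟩ <;> rw [← Scheme.Opens.ι_comp_over] <;> infer_instance

theorem topologicalKrullDim_opens [IsComplexVariety X] (U : X.Opens) [Nonempty U] :
    topologicalKrullDim U.toScheme = topologicalKrullDim X := by
  have := IsComplexVariety.isIntegral (X := X)
  have := IsComplexVariety.locallyOfFiniteType (X := X)
  have := (IsComplexVariety.opens U).locallyOfFiniteType
  have := isDominant_opens_ι U
  have : U.ι.IsOver SpecC := ⟨Scheme.Opens.ι_comp_over U SpecC⟩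
  exact (topologicalKrullDim_eq_iff_isAlgebraic U.ι).mpr (isAlgebraic_of_isOpenImmersion U.ι)

namespace IsBranchedCover

variable {π : X ⤏ Z}

theorem isComplexVariety_domain (h : IsBranchedCover π) : IsComplexVariety h.domain :=
  have := h.source
  have : Nonempty π.domain := by
    have := h.source.isIntegral
    exact π.dense_domain.nonempty.to_subtype
  IsComplexVariety.opens π.domain

theorem topologicalKrullDim_domain (h : IsBranchedCover π) :
    topologicalKrullDim h.domain = topologicalKrullDim Z := by
  have := h.source
  have : Nonempty π.domain := by
    have := h.source.isIntegral
    exact π.dense_domain.nonempty.to_subtype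
  rw [← h.dim_eq]
  exact topologicalKrullDim_opens π.domain

theorem isOver_regularMap (h : IsBranchedCover π) : h.regularMap.IsOver SpecC := by
  have := h.source.isIntegral
  have := h.target
  have := IsComplexVariety.scheme_isSeparated Z
  have := h.isOver
  exact inferInstanceAs (π.toPartialMap.IsOver SpecC)

end IsBranchedCover

/-- The scheme `Y` of a factorization `f ∣_ W = φ ≫ ψ` with `ψ` affine of finite type makes both
factors branched covers. -/
theorem isRegularBranchedCover_of_factorization [IsComplexVariety X] [IsComplexVariety Z]
    [IsIntegral X] [IsIntegral Z]
    (f : X ⟶ Z) [IsDominant f] [f.IsOver SpecC]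
    (hdim : topologicalKrullDim X = topologicalKrullDim Z)
    (W : Z.Opens) [Nonempty W] [Nonempty (f ⁻¹ᵁ W)] {Y : Scheme.{0}} [IsIntegral Y] [Y.Over SpecC]
    (φ : (f ⁻¹ᵁ W).toScheme ⟶ Y) (ψ : Y ⟶ W.toScheme) [IsDominant φ] [IsDominant ψ]
    [ψ.IsOver SpecC] (hcomp : φ ≫ ψ = f ∣_ W) [IsAffineHom ψ] [LocallyOfFiniteType ψ] :
    IsRegularBranchedCover φ ∧ IsRegularBranchedCover ψ := by
  have hX := IsComplexVariety.opens (f ⁻¹ᵁ W)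
  have hW := IsComplexVariety.opens W
  have := hX.locallyOfFiniteType
  have := hW.locallyOfFiniteType
  have := hW.quasiCompact
  have := hW.isSeparated
  have hψ : ψ ≫ W.toScheme ↘ SpecC = Y ↘ SpecC := comp_over ψ SpecC
  have : LocallyOfFiniteType (Y ↘ SpecC) := by rw [← hψ]; infer_instance
  have hY : IsComplexVariety Y := by
    refine ⟨inferInstance, ?_, inferInstance, ?_⟩ <;> rw [← hψ] <;> infer_instance
  have hdim' : topologicalKrullDim (f ⁻¹ᵁ W).toScheme = topologicalKrullDim W.toScheme := by
    rw [topologicalKrullDim_opens, topologicalKrullDim_opens, hdim]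
  have hover : (φ ≫ ψ).IsOver SpecC := by
    refine ⟨?_⟩
    rw [hcomp, ← Scheme.Opens.ι_comp_over, morphismRestrict_ι_assoc, comp_over f SpecC,
      Scheme.Opens.ι_comp_over]
  have hφ : φ.IsOver SpecC := by
    refine ⟨?_⟩
    rw [← hψ, ← Category.assoc]
    exact comp_over (φ ≫ ψ) SpecC
  -- Both dimension equalities follow from algebraicity, which passes from ℂ(X)/ℂ(Z) to the two
  -- steps of the tower.
  obtain ⟨hφalg, hψalg⟩ := isAlgebraic_of_comp φ ψ
    ((topologicalKrullDim_eq_iff_isAlgebraic (φ ≫ ψ)).mp hdim')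
  exact ⟨⟨hX, hY, hφ, inferInstance, (topologicalKrullDim_eq_iff_isAlgebraic φ).mpr hφalg⟩,
    ⟨hY, hW, inferInstance, inferInstance, (topologicalKrullDim_eq_iff_isAlgebraic ψ).mpr hψalg⟩⟩

end BranchedCover

theorem propositionP {X Z : Scheme.{0}} [X.Over SpecC] [Z.Over SpecC] (π : X ⤏ Z)
    (hπ : IsBranchedCover π) :
    hπ.IsDecomposable ↔ hπ.HasImprimitiveGaloisGroup := by
  have := hπ.isIntegral_domain
  have := hπ.target.isIntegral
  have := hπ.isDominant_regularMap
  have := hπ.isOver_regularMap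
  have := hπ.isComplexVariety_domain
  have := hπ.target
  have := IsComplexVariety.locallyOfFiniteType (X := hπ.domain)
  have := IsComplexVariety.locallyOfFiniteType (X := Z)
  have := IsComplexVariety.quasiCompact (X := hπ.domain)
  have := IsComplexVariety.isLocallyNoetherian hπ.domain
  have : Algebra.IsAlgebraic Z.functionField (SourceField hπ.regularMap) :=
    (topologicalKrullDim_eq_iff_isAlgebraic hπ.regularMap).mp hπ.topologicalKrullDim_domain
  have := finiteDimensional_sourceField hπ.regularMap
  have := charZero_functionField (X := Z)
  refine Iff.trans ?_ isImprimitive_galois_iff.symm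
  constructor
  · rintro ⟨V, hV, Y, _, φ, ψ, hφ, hψ, hcomp, hφd, hψd⟩
    have := hφ.source.isIntegral
    have := hψ.source.isIntegral
    have := hψ.target.isIntegral
    have := hφ.isDominant
    have := hψ.isDominant
    have : Nonempty V := hV.nonempty.to_subtype
    have := nonempty_preimage_of_isDominant hπ.regularMap V
    have := isDominant_opens_ι V
    have := isDominant_opens_ι (hπ.regularMap ⁻¹ᵁ V)
    exact exists_intermediateField_of_factorization hπ.regularMap V φ ψ hcomp
      (fun h ↦ hφd ((mapDegree_eq_one_iff φ).mpr h))
      (fun h ↦ hψd ((mapDegree_eq_one_iff ψ).mpr h))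
  · rintro ⟨L, hbot, htop⟩
    obtain ⟨W, hW, hxW⟩ : ∃ W : Z.Opens, IsAffineOpen W ∧ genericPoint Z ∈ W := by
      obtain ⟨_, ⟨W, hW, rfl⟩, hxW, -⟩ := Z.isBasis_affineOpens.exists_subset_of_mem_open
        (Set.mem_univ (genericPoint Z)) isOpen_univ
      exact ⟨W, hW, hxW⟩
    have : Nonempty W := ⟨_, hxW⟩
    have := nonempty_preimage_of_isDominant hπ.regularMap W
    have := isDominant_opens_ι W
    have := isDominant_opens_ι (hπ.regularMap ⁻¹ᵁ W)
    have := (IsComplexVariety.opens (hπ.regularMap ⁻¹ᵁ W)).quasiCompact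
    have : CompactSpace (hπ.regularMap ⁻¹ᵁ W).toScheme :=
      QuasiCompact.compactSpace_of_compactSpace ((hπ.regularMap ⁻¹ᵁ W).toScheme ↘ SpecC)
    obtain ⟨R, _, φ, ψ, _, _, hcomp, _, _, hφs, hψs⟩ :=
      exists_factorization_of_intermediateField hπ.regularMap L hbot htop W hW
    -- The ℂ-structure on Y is defined through ψ, so ψ is a map over ℂ by construction.
    let : (Spec R).Over SpecC := ⟨ψ ≫ W.toScheme ↘ SpecC⟩
    have : ψ.IsOver SpecC := ⟨rfl⟩
    obtain ⟨hφ, hψ⟩ := isRegularBranchedCover_of_factorization hπ.regularMap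
      hπ.topologicalKrullDim_domain W φ ψ hcomp
    exact ⟨W, W.isOpen.dense ⟨_, hxW⟩, Spec R, inferInstance, φ, ψ, hφ, hψ, hcomp,
      fun h ↦ hφs ((mapDegree_eq_one_iff φ).mp h), fun h ↦ hψs ((mapDegree_eq_one_iff ψ).mp h)⟩
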